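/- Let $k$ be an infinite field, $S=k[x_0,\dots,x_n]$ with homogeneous maximal ideal $\mathfrak m=(x_0,\dots,x_n)$, let $W\subset S$ be an $(r+1)$-dimensional $k$-vector space of forms of the same degree with basis $f_0,\dots,f_r$, and let $I=(f_0,\dots,f_r)\subset S$ be the ideal generated by $W$. Assume that $\operatorname{codim} I\ge 2$. Let $\ell(I)$ denote the analytic spread of $I$, i.e. the Krull dimension of $\mathcal R/\mathfrak m\mathcal R$, where $\mathcal R=S[It]$ is the Rees algebra of $I$ (equivalently, one plus the dimension of the image of the rational map $\mathbf P^n\to\mathbf P^r=\mathbf P(W)$ defined by $W$). Let $q$ be a $k$-rational point of $\mathbf P(W)$, that is, a subspace $W_q\subset W$ of codimension $1$, and let $I_q\subset S$ be the ideal generated by $W_q$; write $I_q:I^\infty=\bigcup_i (I_q:I^i)$. Let $A$ be a matrix with $r+1$ rows and finitely many columns whose entries are homogeneous forms in $S$, each of whose columns is a syzygy on $f_0,\dots,f_r$. View $A$ as a map $S^m\to S\otimes_k W$ and let $A_q\subset S$ be the generalized row ideal of $A$ at $q$, i.e. the image of the composition $S^m\to S\otimes_k W\to S\otimes_k (W/W_q)\cong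 S$. If there exists a prime ideal $P$ of $S$ with $A_q\subset P$ such that the matrix $A\otimes\kappa(P)$ over the residue field $\kappa(P)=S_P/PS_P$ has rank $r$, then $I_q:I^\infty\ne S$ and $$\ell(I)\ \ge\ 1+\operatorname{codim} A_q .$$ -/

import Mathlib

/-- The saturation `J : I^∞ = ⋃ i, (J : I ^ i)` of an ideal `J` with respect to an ideal `I`
(the ideals `J : I ^ i` form an increasing chain, so their supremum is their union). -/
def Ideal.colonInfty {R : Type*} [CommRing R] (J I : Ideal R) : Ideal R :=
  ⨆ i : ℕ, Submodule.colon J ((I ^ i : Ideal R) : Set R)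

/-- Sanity check: `J : I^∞` consists of the elements `x` with `x I ^ i ⊆ J` for some `i`. -/
theorem Ideal.mem_colonInfty {R : Type*} [CommRing R] {J I : Ideal R} {x : R} :
    x ∈ J.colonInfty I ↔ ∃ i : ℕ, ∀ y ∈ I ^ i, x * y ∈ J := by
  have hdir : Directed (· ≤ ·)
      fun i : ℕ => Submodule.colon J ((I ^ i : Ideal R) : Set R) := by
    refine Monotone.directed_le fun i j hij => ?_
    exact Submodule.colon_mono le_rfl (Ideal.pow_le_pow_right hij)
  rw [Ideal.colonInfty, Submodule.mem_iSup_of_directed _ hdir]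
  simp [Submodule.mem_colon]

/-- The special fiber ring `𝓡 ⧸ 𝔪 𝓡` of the Rees algebra `𝓡 = R[It] ⊆ R[t]` of an ideal `I`. -/
abbrev Ideal.SpecialFiberRing {R : Type*} [CommRing R] (m I : Ideal R) : Type _ :=
  reesAlgebra I ⧸ m.map (algebraMap R (reesAlgebra I))

/-- The analytic spread `ℓ(I)` of an ideal `I` with respect to the (homogeneous) maximal
ideal `m`: the Krull dimension of the special fiber ring `𝓡 ⧸ m 𝓡 = ⨁ i, I ^ i ⧸ m I ^ i`. -/
noncomputable def Ideal.analyticSpread {R : Type*} [CommRing R] (m I : Ideal R) : WithBot ℕ∞ :=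
  ringKrullDim (Ideal.SpecialFiberRing m I)

/-- Let `b` be a basis of a vector space `W`, let `Wq` be a subspace of codimension one, and let
`A` be a matrix over the `k`-algebra `S` whose rows are indexed by `b`, viewed as a map
`S ^ ι → S ⊗ W`. The generalized row ideal is the image of the composition
`S ^ ι → S ⊗ W → S ⊗ (W ⧸ Wq) ≅ S`, where the last isomorphism is induced by a nonzero functional
`l` on the line `W ⧸ Wq`: it is generated by the entries `∑ i, l(b i) A i j` of the generalized
row. Since any two nonzero functionals are proportional, all of them may be used at once. -/
def generalizedRowIdeal {k S W ρ ι : Type*} [Field k] [CommRing S] [Algebra k S]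
    [AddCommGroup W] [Module k W] [Fintype ρ] (b : Module.Basis ρ k W) (Wq : Submodule k W)
    (A : Matrix ρ ι S) : Ideal S :=
  Ideal.span {s | ∃ (l : Module.Dual k (W ⧸ Wq)) (j : ι),
    s = ∑ i, l (Wq.mkQ (b i)) • A i j}

/-!
Pick `w` in `W` outside the hyperplane `W_q`. Since `A ⊗ κ(P)` has rank `r`, Nakayama's lemma shows
that the projections along `w` of the columns of `A` generate `S_P ⊗ W_q` over `S_P`; because the
columns are syzygies, `I_q` and `w A_q` generate the same ideal of `S_P`. Hence a prime below `P`
contains `I_q` if and only if it contains `w` or `A_q`. If `w` were in `P`, a minimal prime of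
`(w)` below `P` would contain `I = I_q + (w)`, contradicting `codim I ≥ 2` by Krull's principal
ideal theorem. So `P` contains `I_q` but not `I`, which gives `I_q : I^∞ ≠ S`, and a minimal prime
`Q` of `A_q` below `P` is a minimal prime of `I_q` not containing `I`.

As `W` consists of forms of the same degree, the special fiber ring of `I` is the subalgebra
`B = k[W t]` of `S[t]`. The prime `Q S[t]` is minimal over the extension of its contraction to `B`,
because a prime of `S[t]` that contains `W_q t` but not `t` contains `I_q`. So the height of `Q` is
at most the height of this contraction, which lies strictly inside the irrelevant ideal `W t B`.
-/

section HyperplaneSyzygies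

open Matrix

theorem map_ker_eq_span_singleton_mul_range {R M L : Type*} [CommRing R] [AddCommGroup M]
    [Module R M] [Module.Finite R M] [AddCommGroup L] [Module R L] {J : Ideal R}
    (hJ : J ≤ Ideal.jacobson ⊥) {γ ψ : M →ₗ[R] R} {u : M} (hu : γ u = 1) {g : L →ₗ[R] M}
    (hψg : ψ ∘ₗ g = 0) (hg : γ.ker ≤ g.range ⊔ J • ⊤) :
    γ.ker.map ψ = Ideal.span {ψ u} * (γ ∘ₗ g).range := by
  -- The range of `g` need not lie in `ker γ`; its image under the projection `π` onto `ker γ` does,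
  -- and generates `ker γ` by Nakayama's lemma.
  let π : M →ₗ[R] M := LinearMap.id - γ.smulRight u
  have hπ_of_mem : ∀ x ∈ γ.ker, π x = x := fun x hx => by simp_all [π]
  have hπ_range : π.range = γ.ker := by
    refine le_antisymm ?_ fun x hx => ⟨x, hπ_of_mem x hx⟩
    rintro _ ⟨x, rfl⟩
    simp [π, hu]
  have hker_fg : γ.ker.FG := by
    rw [← hπ_range, LinearMap.range_eq_map]
    exact Module.Finite.fg_top.map π
  have hker_le : γ.ker ≤ (π ∘ₗ g).range ⊔ J • γ.ker :=
    calc γ.ker = γ.ker.map π := by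
          refine le_antisymm (fun x hx => ⟨x, hx, hπ_of_mem x hx⟩) ?_
          rw [← hπ_range]
          exact LinearMap.map_le_range
      _ ≤ (g.range ⊔ J • ⊤).map π := Submodule.map_mono hg
      _ = (π ∘ₗ g).range ⊔ J • γ.ker := by
          rw [Submodule.map_sup, Submodule.map_smul'', ← LinearMap.range_eq_map, hπ_range,
            LinearMap.range_comp]
  have hker : γ.ker = (π ∘ₗ g).range := by
    refine le_antisymm (Submodule.le_of_le_smul_of_le_jacobson_bot hker_fg hJ hker_le) ?_
    rw [← hπ_range]
    exact LinearMap.range_comp_le_range g π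
  have hψπg : ∀ y, ψ (π (g y)) = -(ψ u * γ (g y)) := fun y => by
    simp [π, show ψ (g y) = 0 from LinearMap.congr_fun hψg y, mul_comm]
  ext s
  simp only [hker, Submodule.mem_map, LinearMap.mem_range, LinearMap.comp_apply,
    exists_exists_eq_and, Ideal.mem_span_singleton_mul, hψπg]
  exact (Equiv.neg L).exists_congr (by simp)

theorem range_mulVecLin_eq_ker_dotProductBilin {K ρ ι : Type*} [Field K] [Fintype ρ] [Fintype ι]
    {A : Matrix ρ ι K} {c : ρ → K} (hc : c ≠ 0) (hcA : c ᵥ* A = 0)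
    (hA : A.rank + 1 = Fintype.card ρ) :
    A.mulVecLin.range = (dotProductBilin K K c).ker := by
  classical
  have hc' : dotProductBilin K K c ≠ 0 := fun h =>
    hc (dotProduct_eq_zero c fun v => LinearMap.congr_fun h v)
  refine Submodule.eq_of_le_of_finrank_eq ?_ ?_
  · rintro _ ⟨y, rfl⟩
    simp [dotProductBilin, dotProduct_mulVec, hcA]
  · have := Module.Dual.finrank_ker_add_one_of_ne_zero hc'
    rw [Module.finrank_fintype_fun_eq_card, ← hA] at this
    exact (Nat.add_right_cancel this).symm

theorem ker_dotProductBilin_le_range_mulVecLin_sup {R ρ ι : Type*} [CommRing R] [IsLocalRing R]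
    [Fintype ρ] [Fintype ι] {A : Matrix ρ ι R} {c u : ρ → R} (hu : c ⬝ᵥ u = 1)
    (hcA : ∀ j, (c ᵥ* A) j ∈ IsLocalRing.maximalIdeal R)
    (hA : (A.map (IsLocalRing.residue R)).rank + 1 = Fintype.card ρ) :
    (dotProductBilin R R c).ker ≤ A.mulVecLin.range ⊔ IsLocalRing.maximalIdeal R • ⊤ := by
  classical
  let res := IsLocalRing.residue R
  have hc : res ∘ c ≠ 0 := fun h => by
    have := congrArg res hu
    rw [RingHom.map_dotProduct, h] at this
    simp at this
  have hcA' : (res ∘ c) ᵥ* A.map res = 0 := funext fun j => by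
    rw [← RingHom.map_vecMul]
    exact (IsLocalRing.residue_eq_zero_iff _).mpr (hcA j)
  intro x hx
  have hx' : res ∘ x ∈ (A.map res).mulVecLin.range := by
    rw [range_mulVecLin_eq_ker_dotProductBilin hc hcA' hA]
    change (res ∘ c) ⬝ᵥ (res ∘ x) = 0
    rw [← RingHom.map_dotProduct, show c ⬝ᵥ x = 0 from hx, map_zero]
  obtain ⟨ybar, hybar⟩ := hx'
  obtain ⟨y, rfl⟩ := IsLocalRing.residue_surjective.comp_left ybar
  have hsub : ∀ i, (x - A *ᵥ y) i ∈ IsLocalRing.maximalIdeal R := fun i => by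
    rw [← IsLocalRing.residue_eq_zero_iff, Pi.sub_apply, map_sub, sub_eq_zero,
      RingHom.map_mulVec]
    exact (congrFun hybar i).symm
  refine Submodule.mem_sup.mpr ⟨A *ᵥ y, ⟨y, rfl⟩, x - A *ᵥ y, ?_, add_sub_cancel _ _⟩
  rw [pi_eq_sum_univ' (x - A *ᵥ y)]
  exact Submodule.sum_mem _ fun i _ => Submodule.smul_mem_smul (hsub i) trivial

end HyperplaneSyzygies

section PrimeIdeals

theorem le_iff_le_of_map_atPrime_eq {S : Type*} [CommRing S] {P : Ideal S} [P.IsPrime]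
    {J K : Ideal S} (h : J.map (algebraMap S (Localization.AtPrime P)) =
      K.map (algebraMap S (Localization.AtPrime P))) {Q : Ideal S} [hQ : Q.IsPrime] (hQP : Q ≤ P) :
    J ≤ Q ↔ K ≤ Q := by
  have hdisj : Disjoint (P.primeCompl : Set S) Q :=
    Set.disjoint_left.mpr fun _ hP hQ => hP (hQP hQ)
  have hle : ∀ J : Ideal S, J ≤ Q ↔ J.map (algebraMap S (Localization.AtPrime P)) ≤
      Q.map (algebraMap S (Localization.AtPrime P)) := fun J => by
    rw [Ideal.map_le_iff_le_comap]
    exact (iff_of_eq (congrArg (J ≤ ·)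
      (IsLocalization.under_map_of_isPrime_disjoint P.primeCompl _ hQ hdisj))).symm
  rw [hle, hle, h]

theorem colonInfty_ne_top {S : Type*} [CommRing S] {I J P : Ideal S} [P.IsPrime] (hJ : J ≤ P)
    (hI : ¬ I ≤ P) : J.colonInfty I ≠ ⊤ := by
  intro htop
  obtain ⟨i, hi⟩ := Ideal.mem_colonInfty.mp ((Ideal.eq_top_iff_one _).mp htop)
  exact hI (Ideal.IsPrime.le_of_pow_le fun y hy => hJ (by simpa using hi y hy))

theorem exists_isPrime_mem_and_not_le_of_two_le_height {S : Type*} [CommRing S]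
    [IsNoetherianRing S] {I P : Ideal S} [P.IsPrime] (hI : 2 ≤ I.height) {w : S} (hw : w ∈ P) :
    ∃ Q ≤ P, Q.IsPrime ∧ w ∈ Q ∧ ¬ I ≤ Q := by
  obtain ⟨Q, hQ, hQP⟩ := Ideal.exists_minimalPrimes_le ((Ideal.span_singleton_le_iff_mem P).mpr hw)
  have hQ_height := Ideal.height_le_one_of_isPrincipal_of_mem_minimalPrimes _ _ hQ
  exact ⟨Q, hQP, hQ.1.1, hQ.1.2 (Ideal.mem_span_singleton_self w), fun hIQ =>
    absurd ((hI.trans (Ideal.height_mono hIQ)).trans hQ_height) (by decide)⟩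

open Polynomial in
theorem height_le_height_map_C {R : Type*} [CommRing R] [IsNoetherianRing R] (Q : Ideal R)
    [Q.IsPrime] : Q.height ≤ (Q.map (C : R →+* R[X])).height := by
  have : (Q.map (C : R →+* R[X])).LiesOver Q := by
    refine ⟨le_antisymm Ideal.le_comap_map fun x hx => ?_⟩
    simpa using Ideal.mem_map_C_iff.mp (show C x ∈ Q.map C from hx) 0
  rw [Ideal.height_eq_height_add_of_liesOver_of_hasGoingDown Q (Q.map (C : R →+* R[X]))]
  exact le_self_add

theorem height_le_height_under_of_mem_minimalPrimes {B T : Type*} [CommRing B] [CommRing T]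
    [IsNoetherianRing B] [IsNoetherianRing T] [Algebra B T] {q : Ideal T} [q.IsPrime]
    (h : q ∈ ((q.under B).map (algebraMap B T)).minimalPrimes) : q.height ≤ (q.under B).height := by
  have hfiber : (q.map (Ideal.Quotient.mk ((q.under B).map (algebraMap B T)))).height = 0 := by
    rw [Ideal.minimalPrimes_eq_comap] at h
    obtain ⟨q', hq', hqq'⟩ := h
    have := hq'.1.1
    have hmap : q.map (Ideal.Quotient.mk ((q.under B).map (algebraMap B T))) = q' :=
      (congrArg (Ideal.map _) hqq'.symm).trans
        (Ideal.map_comap_of_surjective _ Ideal.Quotient.mk_surjective q')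
    rw [hmap]
    exact Ideal.height_eq_zero_iff.mpr hq'
  simpa [hfiber] using Ideal.height_le_height_add_of_liesOver (q.under B) q

end PrimeIdeals

section GeneralizedRowIdeal

open Matrix

variable {k S R W ρ ι : Type*} [Field k] [CommRing S] [Algebra k S] [CommRing R] [Algebra k R]
  [AddCommGroup W] [Module k W] [Fintype ρ]

theorem exists_ker_eq_of_finrank_quotient_eq_one {V : Submodule k W}
    (hV : Module.finrank k (W ⧸ V) = 1) : ∃ (μ : Module.Dual k W) (w : W), μ.ker = V ∧ μ w = 1 := by
  have : FiniteDimensional k (W ⧸ V) := Module.finite_of_finrank_eq_succ hV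
  let e : (W ⧸ V) ≃ₗ[k] k := LinearEquiv.ofFinrankEq _ _ (by simp [hV])
  obtain ⟨w, hw⟩ := (e.surjective.comp V.mkQ_surjective) 1
  exact ⟨e.toLinearMap ∘ₗ V.mkQ, w, by simp [LinearMap.ker_comp], hw⟩

theorem map_algebraMap_generalizedRowIdeal [Algebra S R] [IsScalarTower k S R]
    (b : Module.Basis ρ k W) (V : Submodule k W) (A : Matrix ρ ι S) :
    (generalizedRowIdeal b V A).map (algebraMap S R) =
      generalizedRowIdeal b V (A.map (algebraMap S R)) := by
  have hentry : ∀ (l : Module.Dual k (W ⧸ V)) (j : ι),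
      algebraMap S R (∑ i, l (V.mkQ (b i)) • A i j) =
        ∑ i, l (V.mkQ (b i)) • A.map (algebraMap S R) i j := fun l j => by
    simp [Algebra.smul_def, ← IsScalarTower.algebraMap_apply]
  rw [generalizedRowIdeal, generalizedRowIdeal, Ideal.map_span]
  congr 1
  ext s
  constructor
  · rintro ⟨_, ⟨l, j, rfl⟩, rfl⟩
    exact ⟨l, j, hentry l j⟩
  · rintro ⟨l, j, rfl⟩
    exact ⟨_, ⟨l, j, rfl⟩, hentry l j⟩

variable {b : Module.Basis ρ k W} {μ : Module.Dual k W} {w : W}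

theorem generalizedRowIdeal_ker_eq_range [Fintype ι] (hw : μ w = 1) (A : Matrix ρ ι R) :
    generalizedRowIdeal b μ.ker A =
      (dotProductBilin R R (algebraMap k R ∘ μ ∘ b) ∘ₗ A.mulVecLin).range := by
  classical
  refine le_antisymm (Ideal.span_le.mpr ?_) ?_
  · rintro _ ⟨l, j, rfl⟩
    have hl : ∀ v, l (μ.ker.mkQ v) = μ v * l (μ.ker.mkQ w) := fun v => by
      have hv : v - μ v • w ∈ μ.ker := by simp [hw]
      simpa using congrArg l ((Submodule.Quotient.eq _).mpr hv)
    refine ⟨Pi.single j (algebraMap k R (l (μ.ker.mkQ w))), ?_⟩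
    change (algebraMap k R ∘ μ ∘ b) ⬝ᵥ A *ᵥ Pi.single j _ = _
    rw [dotProduct_mulVec, dotProduct_single, vecMul, dotProduct, Finset.sum_mul]
    refine Finset.sum_congr rfl fun i _ => ?_
    rw [hl (b i), Algebra.smul_def, map_mul, mul_right_comm]
    rfl
  · rintro _ ⟨x, rfl⟩
    have hx : (algebraMap k R ∘ μ ∘ b) ⬝ᵥ A *ᵥ x = ∑ j, x j * ∑ i, μ (b i) • A i j := by
      rw [dotProduct_mulVec, dotProduct_comm]
      simp [dotProduct, vecMul, Algebra.smul_def]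
    change (algebraMap k R ∘ μ ∘ b) ⬝ᵥ A *ᵥ x ∈ _
    rw [hx]
    exact Ideal.sum_mem _ fun j _ => Ideal.mul_mem_left _ _
      (Ideal.subset_span ⟨μ.ker.liftQ μ le_rfl, j, by simp⟩)

theorem dotProduct_comp_repr (b : Module.Basis ρ k W) (φ : W →ₗ[k] R) (v : W) :
    (φ ∘ b) ⬝ᵥ (algebraMap k R ∘ b.repr v) = φ v := by
  conv_rhs => rw [← b.sum_repr v, map_sum]
  simp [dotProduct, Algebra.smul_def, mul_comm]

theorem span_map_ker_eq_map_ker_dotProductBilin (φ : W →ₗ[k] R) (hw : μ w = 1) :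
    Ideal.span (μ.ker.map φ : Set R) =
      (dotProductBilin R R (algebraMap k R ∘ μ ∘ b)).ker.map (dotProductBilin R R (φ ∘ b)) := by
  refine le_antisymm (Ideal.span_le.mpr ?_) ?_
  · rintro _ ⟨v, hv, rfl⟩
    refine ⟨algebraMap k R ∘ b.repr v, ?_, dotProduct_comp_repr b φ v⟩
    have hμv : μ v = 0 := hv
    exact (dotProduct_comp_repr b (Algebra.linearMap k R ∘ₗ μ) v).trans (by simp [hμv])
  · rintro _ ⟨x, hx, rfl⟩
    have hx' : ∑ i, algebraMap k R (μ (b i)) * x i = 0 := hx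
    have hsum : (φ ∘ b) ⬝ᵥ x = ∑ i, x i * φ (b i - μ (b i) • w) := by
      calc (φ ∘ b) ⬝ᵥ x = ∑ i, φ (b i) * x i - (∑ i, algebraMap k R (μ (b i)) * x i) * φ w := by
            rw [hx', zero_mul, sub_zero]; rfl
        _ = ∑ i, x i * φ (b i - μ (b i) • w) := by
            rw [Finset.sum_mul, ← Finset.sum_sub_distrib]
            refine Finset.sum_congr rfl fun i _ => ?_
            rw [map_sub, map_smul, Algebra.smul_def]
            ring
    change (φ ∘ b) ⬝ᵥ x ∈ _
    rw [hsum]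
    exact Ideal.sum_mem _ fun i _ => Ideal.mul_mem_left _ _
      (Ideal.subset_span ⟨_, by simp [hw], rfl⟩)

theorem span_map_ker_eq_span_singleton_mul_generalizedRowIdeal [IsLocalRing R] [Fintype ι]
    (hw : μ w = 1) (φ : W →ₗ[k] R) {A : Matrix ρ ι R} (hA : ∀ j, ∑ i, A i j * φ (b i) = 0)
    (hmax : generalizedRowIdeal b μ.ker A ≤ IsLocalRing.maximalIdeal R)
    (hrank : (A.map (IsLocalRing.residue R)).rank + 1 = Fintype.card ρ) :
    Ideal.span (μ.ker.map φ : Set R) =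
      Ideal.span {φ w} * generalizedRowIdeal b μ.ker A := by
  classical
  let c : ρ → R := algebraMap k R ∘ μ ∘ b
  let u : ρ → R := algebraMap k R ∘ b.repr w
  have hu : c ⬝ᵥ u = 1 :=
    (dotProduct_comp_repr b (Algebra.linearMap k R ∘ₗ μ) w).trans (by simp [hw])
  have hψg : dotProductBilin R R (φ ∘ b) ∘ₗ A.mulVecLin = 0 := LinearMap.ext fun y => by
    have hfA : (φ ∘ b) ᵥ* A = 0 := funext fun j => by
      simpa [vecMul, dotProduct, mul_comm] using hA j
    change (φ ∘ b) ⬝ᵥ A *ᵥ y = 0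
    rw [dotProduct_mulVec, hfA, zero_dotProduct]
  rw [generalizedRowIdeal_ker_eq_range hw] at hmax ⊢
  have hcA : ∀ j, (c ᵥ* A) j ∈ IsLocalRing.maximalIdeal R := fun j =>
    hmax ⟨Pi.single j 1, by simp [c, dotProductBilin, dotProduct, vecMul]⟩
  have hker := ker_dotProductBilin_le_range_mulVecLin_sup hu hcA hrank
  rw [span_map_ker_eq_map_ker_dotProductBilin (b := b) φ hw,
    map_ker_eq_span_singleton_mul_range (γ := dotProductBilin R R c)
      (IsLocalRing.maximalIdeal_le_jacobson _) hu hψg hker]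
  congr 3
  exact dotProduct_comp_repr b φ w

theorem map_span_map_ker_eq_map_span_singleton_mul_generalizedRowIdeal [Fintype ι]
    (hw : μ w = 1) (φ : W →ₗ[k] S) {A : Matrix ρ ι S} (hA : ∀ j, ∑ i, A i j * φ (b i) = 0)
    {P : Ideal S} [P.IsPrime] (hP : generalizedRowIdeal b μ.ker A ≤ P)
    (hrank : (A.map (algebraMap S P.ResidueField)).rank + 1 = Fintype.card ρ) :
    (Ideal.span (μ.ker.map φ : Set S)).map (algebraMap S (Localization.AtPrime P)) =
      (Ideal.span {φ w} * generalizedRowIdeal b μ.ker A).map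
        (algebraMap S (Localization.AtPrime P)) := by
  let Sₚ := Localization.AtPrime P
  let φₚ : W →ₗ[k] Sₚ := (IsScalarTower.toAlgHom k S Sₚ).toLinearMap ∘ₗ φ
  have hAₚ : ∀ j, ∑ i, A.map (algebraMap S Sₚ) i j * φₚ (b i) = 0 := fun j => by
    simpa [φₚ] using congrArg (algebraMap S Sₚ) (hA j)
  have hmax : generalizedRowIdeal b μ.ker (A.map (algebraMap S Sₚ)) ≤
      IsLocalRing.maximalIdeal Sₚ := by
    rw [← map_algebraMap_generalizedRowIdeal, ← Localization.AtPrime.map_eq_maximalIdeal]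
    exact Ideal.map_mono hP
  have hlocal := span_map_ker_eq_span_singleton_mul_generalizedRowIdeal hw φₚ hAₚ hmax hrank
  rw [← map_algebraMap_generalizedRowIdeal] at hlocal
  rw [Ideal.map_mul, Ideal.map_span, Ideal.map_span, Set.image_singleton]
  simpa [φₚ, Set.image_image] using hlocal

theorem span_map_ker_le_iff [Fintype ι] (hw : μ w = 1) (φ : W →ₗ[k] S) {A : Matrix ρ ι S}
    (hA : ∀ j, ∑ i, A i j * φ (b i) = 0) {P : Ideal S} [P.IsPrime]
    (hP : generalizedRowIdeal b μ.ker A ≤ P)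
    (hrank : (A.map (algebraMap S P.ResidueField)).rank + 1 = Fintype.card ρ) {Q : Ideal S}
    [Q.IsPrime] (hQP : Q ≤ P) :
    Ideal.span (μ.ker.map φ : Set S) ≤ Q ↔ φ w ∈ Q ∨ generalizedRowIdeal b μ.ker A ≤ Q := by
  rw [le_iff_le_of_map_atPrime_eq
    (map_span_map_ker_eq_map_span_singleton_mul_generalizedRowIdeal hw φ hA hP hrank) hQP,
    Ideal.IsPrime.mul_le inferInstance, Ideal.span_singleton_le_iff_mem]

theorem range_le_of_span_map_ker_le (hw : μ w = 1) (φ : W →ₗ[k] S) {Q : Ideal S}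
    (hQ : Ideal.span (μ.ker.map φ : Set S) ≤ Q) (hwQ : φ w ∈ Q) :
    Ideal.span (φ.range : Set S) ≤ Q := by
  refine Ideal.span_le.mpr ?_
  rintro _ ⟨v, rfl⟩
  have hv : v - μ v • w ∈ μ.ker := by simp [hw]
  have hφv : φ v = φ (v - μ v • w) + μ v • φ w := by simp
  rw [hφv]
  exact Q.add_mem (hQ (Ideal.subset_span ⟨_, hv, rfl⟩)) (Submodule.smul_of_tower_mem Q _ hwQ)

theorem apply_notMem_of_two_le_height [IsNoetherianRing S] [Fintype ι] (hw : μ w = 1)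
    (φ : W →ₗ[k] S) (hφ : 2 ≤ (Ideal.span (φ.range : Set S)).height) {A : Matrix ρ ι S}
    (hA : ∀ j, ∑ i, A i j * φ (b i) = 0) {P : Ideal S} [P.IsPrime]
    (hP : generalizedRowIdeal b μ.ker A ≤ P)
    (hrank : (A.map (algebraMap S P.ResidueField)).rank + 1 = Fintype.card ρ) : φ w ∉ P := by
  intro hwP
  obtain ⟨Q, hQP, _, hwQ, hQ⟩ := exists_isPrime_mem_and_not_le_of_two_le_height hφ hwP
  exact hQ (range_le_of_span_map_ker_le hw φ
    ((span_map_ker_le_iff hw φ hA hP hrank hQP).mpr (Or.inl hwQ)) hwQ)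

theorem mem_minimalPrimes_span_map_ker [Fintype ι] (hw : μ w = 1) (φ : W →ₗ[k] S)
    {A : Matrix ρ ι S} (hA : ∀ j, ∑ i, A i j * φ (b i) = 0) {P : Ideal S} [P.IsPrime]
    (hP : generalizedRowIdeal b μ.ker A ≤ P)
    (hrank : (A.map (algebraMap S P.ResidueField)).rank + 1 = Fintype.card ρ) (hwP : φ w ∉ P)
    {Q : Ideal S} (hQP : Q ≤ P) (hQ : Q ∈ (generalizedRowIdeal b μ.ker A).minimalPrimes) :
    Q ∈ (Ideal.span (μ.ker.map φ : Set S)).minimalPrimes := by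
  have hle_iff : ∀ Q' ≤ P, Q'.IsPrime →
      (Ideal.span (μ.ker.map φ : Set S) ≤ Q' ↔ generalizedRowIdeal b μ.ker A ≤ Q') :=
    fun Q' hQ'P _ => (span_map_ker_le_iff hw φ hA hP hrank hQ'P).trans
      (or_iff_right fun hwQ' => hwP (hQ'P hwQ'))
  exact ⟨⟨hQ.1.1, (hle_iff Q hQP hQ.1.1).mpr hQ.1.2⟩, fun Q' hQ' hQ'Q =>
    hQ.2 ⟨hQ'.1, (hle_iff Q' (hQ'Q.trans hQP) hQ'.1).mp hQ'.2⟩ hQ'Q⟩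

end GeneralizedRowIdeal

section FiberAlgebra

open Polynomial

theorem reesAlgebra_span_eq_adjoin {S : Type*} [CommRing S] (s : Set S) :
    reesAlgebra (Ideal.span s) = Algebra.adjoin S (monomial 1 '' s) := by
  rw [← adjoin_monomial_eq_reesAlgebra, Ideal.span, Submodule.map_span, Algebra.adjoin_span]

theorem coeff_mem_mul_pow_of_mem_map_reesAlgebra {S : Type*} [CommRing S] {m I : Ideal S}
    {x : reesAlgebra I} (hx : x ∈ m.map (algebraMap S (reesAlgebra I))) (j : ℕ) :
    (x : S[X]).coeff j ∈ m * I ^ j := by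
  induction hx using Submodule.span_induction generalizing j with
  | mem x hx =>
    obtain ⟨s, hs, rfl⟩ := hx
    change (C s).coeff j ∈ _
    rw [coeff_C]
    split_ifs with h
    · simpa [h] using hs
    · exact zero_mem _
  | zero => simp
  | add x y _ _ hx hy => simpa using add_mem (hx j) (hy j)
  | smul a x _ hx =>
    rw [smul_eq_mul, Subalgebra.coe_mul, coeff_mul]
    refine sum_mem fun p hp => ?_
    rw [← Finset.HasAntidiagonal.mem_antidiagonal.mp hp, pow_add, mul_left_comm]
    exact Ideal.mul_mem_mul (a.2 _) (hx _)

/-- The subalgebra `k[W t]` of `S[t]` generated by `W t`, for a `k`-submodule `W` of `S`. If `W`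
is a space of forms of the same degree, it is the homogeneous coordinate ring of the image of the
rational map defined by `W`. -/
noncomputable abbrev fiberAlgebra {k S : Type*} [CommRing k] [CommRing S] [Algebra k S]
    (W : Submodule k S) : Subalgebra k S[X] :=
  Algebra.adjoin k (monomial 1 '' (W : Set S))

namespace fiberAlgebra

section CommRing

variable {k S : Type*} [CommRing k] [CommRing S] [Algebra k S] {W : Submodule k S}

theorem monomial_one_mem {w : S} (hw : w ∈ W) : monomial 1 w ∈ fiberAlgebra W :=
  Algebra.subset_adjoin ⟨w, hw, rfl⟩

theorem coeff_mem_pow {x : S[X]} (hx : x ∈ fiberAlgebra W) (j : ℕ) : x.coeff j ∈ W ^ j := by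
  induction hx using Algebra.adjoin_induction generalizing j with
  | mem x hx =>
    obtain ⟨w, hw, rfl⟩ := hx
    rw [coeff_monomial]
    split_ifs with h
    · simpa [← h] using hw
    · exact zero_mem _
  | algebraMap c =>
    rw [Polynomial.algebraMap_apply, coeff_C]
    split_ifs with h
    · simp [h]
    · exact zero_mem _
  | add x y _ _ hx hy => simpa using add_mem (hx j) (hy j)
  | mul x y _ _ hx hy =>
    rw [coeff_mul]
    refine sum_mem fun p hp => ?_
    rw [← Finset.HasAntidiagonal.mem_antidiagonal.mp hp, pow_add]
    exact Submodule.mul_mem_mul (hx _) (hy _)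

theorem le_reesAlgebra (W : Submodule k S) :
    fiberAlgebra W ≤ (reesAlgebra (Ideal.span (W : Set S))).restrictScalars k := by
  refine Algebra.adjoin_le ?_
  rintro _ ⟨w, hw, rfl⟩
  exact reesAlgebra.monomial_mem.mpr (by simpa using Ideal.subset_span hw)

theorem isNoetherianRing [IsNoetherianRing k] (hW : W.FG) : IsNoetherianRing (fiberAlgebra W) := by
  obtain ⟨s, rfl⟩ := hW
  refine isNoetherianRing_of_fg (Subalgebra.fg_def.mpr
    ⟨monomial 1 '' (s : Set S), s.finite_toSet.image _, ?_⟩)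
  rw [fiberAlgebra, ← Algebra.adjoin_span (R := k) (s := monomial 1 '' (s : Set S))]
  congr 1
  exact congrArg SetLike.coe
    (Submodule.map_span ((monomial 1 : S →ₗ[S] S[X]).restrictScalars k) s).symm

/-- The natural map from `k[W t]` to the special fiber ring of the ideal generated by `W`. It is
an isomorphism when `W` is a space of forms of the same degree. -/
noncomputable def toSpecialFiberRing (W : Submodule k S) (m : Ideal S) :
    fiberAlgebra W →+* m.SpecialFiberRing (Ideal.span (W : Set S)) :=
  (Ideal.Quotient.mk _).comp (Subalgebra.inclusion (le_reesAlgebra W)).toRingHom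

variable {m : Ideal S}

theorem toSpecialFiberRing_surjective (hm : ∀ s : S, ∃ c : k, s - algebraMap k S c ∈ m) :
    Function.Surjective (toSpecialFiberRing W m) := by
  set I := Ideal.span (W : Set S)
  let range := (toSpecialFiberRing W m).range
  suffices h : ∀ x ∈ Algebra.adjoin S (monomial 1 '' (W : Set S)), ∀ hx : x ∈ reesAlgebra I,
      Ideal.Quotient.mk (m.map (algebraMap S (reesAlgebra I))) ⟨x, hx⟩ ∈ range by
    intro y
    obtain ⟨x, rfl⟩ := Ideal.Quotient.mk_surjective y
    exact h x (reesAlgebra_span_eq_adjoin (W : Set S) ▸ x.2) x.2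
  intro x hx
  induction hx using Algebra.adjoin_induction with
  | mem x hx =>
    exact fun _ => ⟨⟨x, Algebra.subset_adjoin hx⟩, rfl⟩
  | algebraMap s =>
    intro _
    obtain ⟨c, hc⟩ := hm s
    refine ⟨algebraMap k _ c, (Ideal.Quotient.eq.mpr ?_).symm⟩
    have := Ideal.mem_map_of_mem (algebraMap S (reesAlgebra I)) hc
    rw [map_sub] at this
    exact this
  | add x y hx hy hx' hy' =>
    rw [← reesAlgebra_span_eq_adjoin] at hx hy
    exact fun _ => range.add_mem (hx' hx) (hy' hy)
  | mul x y hx hy hx' hy' =>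
    rw [← reesAlgebra_span_eq_adjoin] at hx hy
    exact fun _ => range.mul_mem (hx' hx) (hy' hy)

theorem toSpecialFiberRing_injective
    (h : ∀ j, ∀ s ∈ W ^ j, s ∈ m * Ideal.span (W : Set S) ^ j → s = 0) :
    Function.Injective (toSpecialFiberRing W m) := by
  refine (injective_iff_map_eq_zero _).mpr fun x hx => ?_
  have hx' := coeff_mem_mul_pow_of_mem_map_reesAlgebra (Ideal.Quotient.eq_zero_iff_mem.mp hx)
  ext1
  ext1 j
  exact h j _ (coeff_mem_pow x.2 j) (hx' j)

variable {V : Submodule k S} {Q : Ideal S}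

theorem map_C_mem_minimalPrimes_map_under (hVW : V ≤ W)
    (hQ : Q ∈ (Ideal.span (V : Set S)).minimalPrimes) :
    Q.map C ∈ (((Q.map C).under (fiberAlgebra W)).map
      (algebraMap (fiberAlgebra W) S[X])).minimalPrimes := by
  have hQ_prime : Q.IsPrime := hQ.1.1
  refine ⟨⟨Ideal.isPrime_map_C_of_isPrime, Ideal.map_comap_le⟩, fun q ⟨hq, hle⟩ hqQ => ?_⟩
  have hX : X ∉ q := fun h =>
    hQ_prime.one_notMem (by simpa using Ideal.mem_map_C_iff.mp (hqQ h) 1)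
  have hVq : Ideal.span (V : Set S) ≤ q.comap C := Ideal.span_le.mpr fun v hv => by
    have hvX : C v * X ∈ q := by
      rw [C_mul_X_eq_monomial]
      let vX : fiberAlgebra W := ⟨monomial 1 v, monomial_one_mem (hVW hv)⟩
      refine hle (Ideal.mem_map_of_mem _ (x := vX) ?_)
      change monomial 1 v ∈ Q.map C
      rw [← C_mul_X_eq_monomial]
      exact Ideal.mul_mem_right _ _ (Ideal.mem_map_of_mem C (hQ.1.2 (Ideal.subset_span hv)))
    exact (hq.mem_or_mem hvX).resolve_right hX
  have hqQ' : q.comap C ≤ Q := fun s hs => by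
    simpa using Ideal.mem_map_C_iff.mp (hqQ hs) 0
  exact Ideal.map_le_iff_le_comap.mpr (hQ.2 ⟨hq.comap C, hVq⟩ hqQ')

/-- The ideal generated by `W t` in `k[W t]`, encoded as the kernel of the constant coefficient; its
height bounds the dimension of `k[W t]` from below. -/
noncomputable def irrelevantIdeal (W : Submodule k S) : Ideal (fiberAlgebra W) :=
  RingHom.ker (constantCoeff.comp (algebraMap (fiberAlgebra W) S[X]))

instance [IsDomain S] : (irrelevantIdeal W).IsPrime :=
  RingHom.ker_isPrime _

end CommRing

section Field

variable {k S : Type*} [Field k] [CommRing S] [Algebra k S] {V W : Submodule k S} {Q : Ideal S}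

theorem under_map_C_lt_irrelevantIdeal [Q.IsPrime] (hWQ : ¬ (W : Set S) ⊆ Q) :
    (Q.map C).under (fiberAlgebra W) < irrelevantIdeal W := by
  refine SetLike.lt_iff_le_and_exists.mpr ⟨fun x hx => ?_, ?_⟩
  · have hxQ : (x : S[X]).coeff 0 ∈ Q := Ideal.mem_map_C_iff.mp hx 0
    obtain ⟨c, hc⟩ := Submodule.mem_one.mp (pow_zero W ▸ coeff_mem_pow x.2 0)
    change (x : S[X]).coeff 0 = 0
    rw [← hc] at hxQ ⊢
    by_contra hc0
    have hc0' : c ≠ 0 := fun h => hc0 (by simp [h])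
    exact ‹Q.IsPrime›.ne_top (Ideal.eq_top_of_isUnit_mem _ hxQ ((IsUnit.mk0 c hc0').map _))
  · obtain ⟨w, hw, hwQ⟩ := Set.not_subset.mp hWQ
    refine ⟨⟨_, monomial_one_mem hw⟩, ?_, fun h => ?_⟩
    · change (monomial 1 w).coeff 0 = 0
      simp [coeff_monomial]
    · have h1 : (monomial 1 w).coeff 1 ∈ Q := Ideal.mem_map_C_iff.mp h 1
      exact hwQ (by simpa using h1)

theorem height_add_one_le_ringKrullDim [IsDomain S] [IsNoetherianRing S] (hW : W.FG) (hVW : V ≤ W)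
    (hQ : Q ∈ (Ideal.span (V : Set S)).minimalPrimes) (hWQ : ¬ (W : Set S) ⊆ Q) :
    ((Q.height + 1 : ℕ∞) : WithBot ℕ∞) ≤ ringKrullDim (fiberAlgebra W) := by
  have := hQ.1.1
  have := isNoetherianRing hW
  have hmin := map_C_mem_minimalPrimes_map_under hVW hQ
  have : (Q.map (C : S →+* S[X])).IsPrime := hmin.1.1
  calc ((Q.height + 1 : ℕ∞) : WithBot ℕ∞)
      ≤ ((((Q.map C).under (fiberAlgebra W)).height + 1 : ℕ∞) : WithBot ℕ∞) :=
        WithBot.coe_le_coe.mpr (add_le_add_left ((height_le_height_map_C Q).trans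
          (height_le_height_under_of_mem_minimalPrimes hmin)) 1)
    _ ≤ (irrelevantIdeal W).height := by
        exact_mod_cast Ideal.height_add_one_le_of_lt_of_isPrime (under_map_C_lt_irrelevantIdeal hWQ)
    _ ≤ ringKrullDim (fiberAlgebra W) := Ideal.height_le_ringKrullDim_of_isPrime

end Field

end fiberAlgebra

section Forms

variable {k σ : Type*} [CommRing k] {W : Submodule k (MvPolynomial σ k)} {d : ℕ}

theorem isHomogeneous_of_mem_pow (hW : W ≤ MvPolynomial.homogeneousSubmodule σ k d) {j : ℕ}
    {p : MvPolynomial σ k} (hp : p ∈ W ^ j) : p.IsHomogeneous (d * j) := by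
  induction hp using Submodule.pow_induction_on_left' with
  | algebraMap c => simpa using MvPolynomial.isHomogeneous_C σ c
  | add x y i _ _ hx hy => exact hx.add hy
  | mem_mul w hw i x _ hx =>
    rw [Nat.succ_eq_add_one, mul_add, mul_one, add_comm]
    exact (hW hw).mul hx

theorem span_le_pow_idealOfVars (hW : W ≤ MvPolynomial.homogeneousSubmodule σ k d) :
    Ideal.span (W : Set (MvPolynomial σ k)) ≤ MvPolynomial.idealOfVars σ k ^ d := by
  refine Ideal.span_le.mpr fun w hw => ?_
  rw [SetLike.mem_coe, MvPolynomial.mem_pow_idealOfVars_iff']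
  exact fun x hx => (hW hw).coeff_eq_zero hx.ne

theorem eq_zero_of_isHomogeneous_of_mem_pow_idealOfVars {p : MvPolynomial σ k} {n : ℕ}
    (hp : p.IsHomogeneous n) (hmem : p ∈ MvPolynomial.idealOfVars σ k ^ (n + 1)) : p = 0 := by
  rw [MvPolynomial.mem_pow_idealOfVars_iff'] at hmem
  ext e
  by_cases he : e.degree = n
  · simpa using hmem e (by omega)
  · simpa using hp.coeff_eq_zero he

theorem sub_C_constantCoeff_mem_idealOfVars (p : MvPolynomial σ k) :
    p - MvPolynomial.C p.constantCoeff ∈ MvPolynomial.idealOfVars σ k := by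
  rw [← pow_one (MvPolynomial.idealOfVars σ k), MvPolynomial.mem_pow_idealOfVars_iff']
  intro e he
  obtain rfl : e = 0 := (Finsupp.degree_eq_zero_iff e).mp (Nat.lt_one_iff.mp he)
  simp [MvPolynomial.constantCoeff_eq]

theorem analyticSpread_span_eq_ringKrullDim_fiberAlgebra
    (hW : W ≤ MvPolynomial.homogeneousSubmodule σ k d) :
    (MvPolynomial.idealOfVars σ k).analyticSpread (Ideal.span (W : Set (MvPolynomial σ k))) =
      ringKrullDim (fiberAlgebra W) := by
  have hinj := fiberAlgebra.toSpecialFiberRing_injective (W := W)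
    (m := MvPolynomial.idealOfVars σ k) fun j s hs hmem => by
      refine eq_zero_of_isHomogeneous_of_mem_pow_idealOfVars (isHomogeneous_of_mem_pow hW hs) ?_
      rw [pow_succ', pow_mul]
      exact Ideal.mul_mono_right (Ideal.pow_right_mono (span_le_pow_idealOfVars hW) j) hmem
  have hsurj := fiberAlgebra.toSpecialFiberRing_surjective (W := W)
    fun p => ⟨_, sub_C_constantCoeff_mem_idealOfVars p⟩
  let e : fiberAlgebra W ≃+* (MvPolynomial.idealOfVars σ k).SpecialFiberRing (Ideal.span W) :=
    RingEquiv.ofBijective _ ⟨hinj, hsurj⟩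
  exact (ringKrullDim_eq_of_ringEquiv e).symm

end Forms

end FiberAlgebra

theorem mainTheorem4_general {k σ ρ ι : Type*} [Field k] [Finite σ] [Fintype ρ] [Fintype ι] {d : ℕ}
    {W : Submodule k (MvPolynomial σ k)} (hWd : W ≤ MvPolynomial.homogeneousSubmodule σ k d)
    (b : Module.Basis ρ k W) (hcodim : 2 ≤ (Ideal.span (W : Set (MvPolynomial σ k))).height)
    {A : Matrix ρ ι (MvPolynomial σ k)}
    (hAsyz : ∀ j, ∑ i, A i j * (b i : MvPolynomial σ k) = 0)
    {Wq : Submodule k W} (hWq : Module.finrank k (W ⧸ Wq) = 1)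
    (hP : ∃ (P : Ideal (MvPolynomial σ k)) (_ : P.IsPrime), generalizedRowIdeal b Wq A ≤ P ∧
      (A.map (algebraMap (MvPolynomial σ k) P.ResidueField)).rank + 1 = Fintype.card ρ) :
    (Ideal.span (Wq.map W.subtype : Set (MvPolynomial σ k))).colonInfty
        (Ideal.span (W : Set (MvPolynomial σ k))) ≠ ⊤ ∧
      1 + ((generalizedRowIdeal b Wq A).height : WithBot ℕ∞) ≤
        Ideal.analyticSpread (MvPolynomial.idealOfVars σ k)
          (Ideal.span (W : Set (MvPolynomial σ k))) := by
  obtain ⟨μ, w, rfl, hw⟩ := exists_ker_eq_of_finrank_quotient_eq_one hWq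
  obtain ⟨P, _, hAP, hrank⟩ := hP
  have hwP : (w : MvPolynomial σ k) ∉ P := apply_notMem_of_two_le_height hw W.subtype
    (by rwa [Submodule.range_subtype]) hAsyz hAP hrank
  have hW_not_le : ∀ Q ≤ P, ¬ (W : Set (MvPolynomial σ k)) ⊆ Q := fun Q hQP hWQ =>
    hwP (hQP (hWQ w.2))
  refine ⟨colonInfty_ne_top ((span_map_ker_le_iff hw W.subtype hAsyz hAP hrank le_rfl).mpr
    (Or.inr hAP)) (mt Ideal.span_le.mp (hW_not_le P le_rfl)), ?_⟩
  obtain ⟨Q, hQ, hQP⟩ := Ideal.exists_minimalPrimes_le hAP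
  have hQ' := mem_minimalPrimes_span_map_ker hw W.subtype hAsyz hAP hrank hwP hQP hQ
  have : FiniteDimensional k W := b.finiteDimensional_of_finite
  rw [analyticSpread_span_eq_ringKrullDim_fiberAlgebra hWd, add_comm]
  calc ((generalizedRowIdeal b μ.ker A).height : WithBot ℕ∞) + 1
      ≤ ((Q.height + 1 : ℕ∞) : WithBot ℕ∞) := by
        exact_mod_cast add_le_add_left (Ideal.height_mono hQ.1.2) 1
    _ ≤ ringKrullDim (fiberAlgebra W) := fiberAlgebra.height_add_one_le_ringKrullDim
        (Module.Finite.iff_fg.mp this) (Submodule.map_subtype_le W μ.ker) hQ'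
        (hW_not_le Q hQP)

theorem mainTheorem4 {k : Type*} [Field k] [Infinite k] (n r d m : ℕ)
    (W : Submodule k (MvPolynomial (Fin (n + 1)) k))
    (hWd : W ≤ MvPolynomial.homogeneousSubmodule (Fin (n + 1)) k d)
    (b : Module.Basis (Fin (r + 1)) k W)
    (I : Ideal (MvPolynomial (Fin (n + 1)) k))
    (hI : I = Ideal.span (W : Set (MvPolynomial (Fin (n + 1)) k)))
    (hcodim : 2 ≤ I.height)
    (A : Matrix (Fin (r + 1)) (Fin m) (MvPolynomial (Fin (n + 1)) k))
    (hAhom : ∀ i j, ∃ e : ℕ, (A i j).IsHomogeneous e)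
    (hAsyz : ∀ j, ∑ i, A i j * (b i : MvPolynomial (Fin (n + 1)) k) = 0)
    (Wq : Submodule k W) (hWq : Module.finrank k (W ⧸ Wq) = 1)
    (Iq : Ideal (MvPolynomial (Fin (n + 1)) k))
    (hIq : Iq = Ideal.span (Wq.map W.subtype : Set (MvPolynomial (Fin (n + 1)) k)))
    (hP : ∃ (P : Ideal (MvPolynomial (Fin (n + 1)) k)) (_ : P.IsPrime),
      generalizedRowIdeal b Wq A ≤ P ∧
        (A.map (algebraMap (MvPolynomial (Fin (n + 1)) k) P.ResidueField)).rank = r) :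
    Iq.colonInfty I ≠ ⊤ ∧
      1 + ((generalizedRowIdeal b Wq A).height : WithBot ℕ∞) ≤
        Ideal.analyticSpread (MvPolynomial.idealOfVars (Fin (n + 1)) k) I := by
  subst hI hIq
  exact mainTheorem4_general hWd b hcodim hAsyz hWq (by simpa using hP)
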